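/- Let $(X_n)_{n\ge 1}$ be independent, identically distributed real random variables whose distribution function $F$ has a tail $\bar F=1-F$ that is regularly varying with index $-1/\xi$, where $0<\xi<1$; that is, $\lim_{t\to\infty}\bar F(tx)/\bar F(t)=x^{-1/\xi}$ for every $x>0$. Let $(k_n)$ be a sequence of positive integers with $k_n\to\infty$ and $k_n/n\to 0$. For each $n$ let $X_{(1)}\ge X_{(2)}\ge\dots\ge X_{(n)}$ be the order statistics of $X_1,\dots,X_n$, and let $$\hat M(u)=\frac{\sum_{j=1}^n (X_j-u)\,\mathbf 1[X_j>u]}{\sum_{j=1}^n \mathbf 1[X_j>u]}$$ be the empirical mean excess function (with $\hat M(u)=0$, say, when no $X_j$ exceeds $u$). Write $k=k_n$. Then, as $n\to\infty$, $$\mathcal S_n:=\frac1{X_{(k)}}\Big\{\big(X_{(i)},\hat M(X_{(i)})\big): i=2,\dots,k\Big\}\ \longrightarrow\ \mathcal S:=\Big\{\Big(t,\frac{\xi}{1-\xi}\,t\Big): t\ge 1\Big\}$$ in probability, in the space of closed subsets of $\mathbb R^2$ with the Fell topology (the topology generated by the families $\{F: F\cap K=\emptyset\}$, $K$ compact, and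 $\{F: F\cap G\ne\emptyset\}$, $G$ open). That is, for every Fell neighbourhood $\mathcal U$ of $\mathcal S$, $P[\mathcal S_n\notin\mathcal U]\to 0$. (On the event $X_{(k)}=0$, whose probability tends to $0$, and for the finitely many $n$ with $k_n>n$, the definition of $\mathcal S_n$ is immaterial.) -/

import Mathlib

open MeasureTheory ProbabilityTheory Filter Topology Set
open scoped Pointwise

noncomputable section

namespace MeanExcess

/-- The upper order statistic `X_(i)` of the sample `x`, for `1 ≤ i ≤ n`, so that
`X_(1) ≥ X_(2) ≥ ⋯ ≥ X_(n)`. (`Tuple.sort x` sorts the sample increasingly, and its `i`-th largest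
entry is the one in place `n - i`, counted from `0`.) It is set to `0` for other `i`. -/
def upperOrderStat {n : ℕ} (x : Fin n → ℝ) (i : ℕ) : ℝ :=
  if h : 1 ≤ i ∧ i ≤ n then x (Tuple.sort x ⟨n - i, by omega⟩) else 0

/-- The empirical mean excess function
`M̂(u) = ∑ (x_j - u) 1[x_j > u] / ∑ 1[x_j > u]` of the sample `x`. -/
def empiricalMeanExcess {n : ℕ} (x : Fin n → ℝ) (u : ℝ) : ℝ :=
  (∑ j, if u < x j then x j - u else 0) / (∑ j, if u < x j then (1 : ℝ) else 0)

/-- The part `{(X_(i), M̂(X_(i))) : i = 2, …, k}` of the mean excess plot of the sample `x`. -/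
def topPlot {n : ℕ} (x : Fin n → ℝ) (k : ℕ) : Set (ℝ × ℝ) :=
  (fun i => (upperOrderStat x i, empiricalMeanExcess x (upperOrderStat x i))) '' Set.Icc 2 k

/-- The closed set `X_(k)⁻¹ • {(X_(i), M̂(X_(i))) : i = 2, …, k}`. -/
def scaledPlot {n : ℕ} (x : Fin n → ℝ) (k : ℕ) : TopologicalSpace.Closeds (ℝ × ℝ) where
  carrier := (1 / upperOrderStat x k) • topPlot x k
  isClosed' := (((Set.finite_Icc 2 k).image _).smul_set).isClosed

/-- The closed half-line `{(t, ξ / (1 - ξ) * t) : t ≥ 1}`. -/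
def limitLine (ξ : ℝ) : TopologicalSpace.Closeds (ℝ × ℝ) where
  carrier := {p | ∃ t : ℝ, 1 ≤ t ∧ p = (t, ξ / (1 - ξ) * t)}
  isClosed' := by
    have h : {p : ℝ × ℝ | ∃ t : ℝ, 1 ≤ t ∧ p = (t, ξ / (1 - ξ) * t)}
        = {p : ℝ × ℝ | 1 ≤ p.1} ∩ {p : ℝ × ℝ | p.2 = ξ / (1 - ξ) * p.1} := by
      ext ⟨a, b⟩
      constructor
      · rintro ⟨t, ht, hp⟩
        obtain ⟨rfl, rfl⟩ := Prod.mk.inj hp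
        exact ⟨ht, rfl⟩
      · rintro ⟨ha, hb⟩
        exact ⟨a, ha, Prod.ext rfl hb⟩
    rw [h]
    exact (isClosed_le continuous_const continuous_fst).inter
      (isClosed_eq continuous_snd (continuous_const.mul continuous_fst))

/-- The Fell topology on the closed subsets of `E`: it is generated by the families
`{F : F ∩ K = ∅}`, `K` compact, and `{F : F ∩ G ≠ ∅}`, `G` open. -/
@[reducible] def fellTopology (E : Type*) [TopologicalSpace E] :
    TopologicalSpace (TopologicalSpace.Closeds E) :=
  TopologicalSpace.generateFrom
    ({A | ∃ K : Set E, IsCompact K ∧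
        A = {F : TopologicalSpace.Closeds E | (F : Set E) ∩ K = ∅}} ∪
      {A | ∃ G : Set E, IsOpen G ∧
        A = {F : TopologicalSpace.Closeds E | ((F : Set E) ∩ G).Nonempty}})

/-- Convergence in probability, with respect to the topology `τ`, of the random elements `S n` to
the deterministic element `s`: every neighbourhood of `s` contains `S n` with probability tending
to `1`. -/
def TendstoInProb {Ω T : Type*} [MeasurableSpace Ω] (μ : Measure Ω) (τ : TopologicalSpace T)
    (S : ℕ → Ω → T) (s : T) : Prop :=
  ∀ U ∈ @nhds T τ s, Tendsto (fun n => μ {ω | S n ω ∉ U}) atTop (𝓝 0)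

/-- For every metric that induces the topology, this is the usual notion: the distance exceeds any
given `ε > 0` with probability tending to `0`. -/
theorem tendstoInProb_iff_tendstoInMeasure {Ω T : Type*} [MeasurableSpace Ω] (μ : Measure Ω)
    [m : MetricSpace T] (S : ℕ → Ω → T) (s : T) :
    TendstoInProb μ m.toUniformSpace.toTopologicalSpace S s ↔
      TendstoInMeasure μ S atTop (fun _ => s) := by
  rw [tendstoInMeasure_iff_dist]
  constructor
  · intro h ε hε
    refine (h _ (Metric.ball_mem_nhds s hε)).congr fun n => ?_
    simp [Metric.mem_ball]
  · intro h U hU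
    obtain ⟨ε, hε, hb⟩ := Metric.mem_nhds_iff.1 hU
    refine tendsto_of_tendsto_of_tendsto_of_le_of_le tendsto_const_nhds (h ε hε)
      (fun _ => zero_le) fun n => measure_mono fun ω hω => ?_
    by_contra hc
    exact hω (hb (by simpa [Metric.mem_ball] using hc))

/-- `U : (0, ∞) → [0, ∞)` is regularly varying with index `ρ` (at infinity). -/
def RegularlyVarying (U : ℝ → ℝ) (ρ : ℝ) : Prop :=
  (∀ t, 0 < t → 0 ≤ U t) ∧
    ∀ x : ℝ, 0 < x → Tendsto (fun t => U (t * x) / U t) atTop (𝓝 (x ^ ρ))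

end MeanExcess

end

/-! ### Order statistics and mean excess of a fixed sample -/

namespace MeanExcess

/-! Put `α = 1 / ξ > 1` and choose levels `a n → ∞` with `n * F̄ (a n) ∼ k n` (`exists_scale`). For
each fixed `t > 0`, let `N` be the number of points above `a n * t` and `S` the sum of their
excesses. Regular variation and Karamata's theorem give the limits of the means of `N / k` and `S /
(a k)`, and a weak law (`tendsto_sum_div`) yields `N / k → t ^ (-α)` and `S / (a k) → t ^ (1 - α) /
(α - 1)` in probability. Their quotient is `t / (α - 1) = ξ / (1 - ξ) * t`.

No uniform law is needed: numerator and denominator of the mean excess are antitone in the level, so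
its values at all levels between `a x` and `a y` are controlled by the two endpoints
(`eventually_mem_band`). Counting points above a level also locates the order statistics, whence
`X_(k) / a → 1`.

For the Fell topology, a compact set off the line is missed because each of its points has a
neighbourhood missed with high probability. An open set meeting the line is hit because more points
lie above `a x` than above `a y` when `x < y`, so some order statistic lies in between.

Convergence in probability is convergence along `probFilter`, so after the weak law the argument is
ordinary limit calculus. -/

/-- The number of sample points above `u`. -/
noncomputable def exceedances {n : ℕ} (x : Fin n → ℝ) (u : ℝ) : ℝ := ∑ j, if u < x j then (1 : ℝ) else 0

/-- The sum of the excesses of the sample points over `u`. -/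
noncomputable def excessSum {n : ℕ} (x : Fin n → ℝ) (u : ℝ) : ℝ := ∑ j, if u < x j then x j - u else 0

section Sample

variable {n : ℕ} (x : Fin n → ℝ)

theorem exceedances_eq_card (u : ℝ) :
    exceedances x u = ((Finset.univ.filter fun j => u < x j).card : ℝ) := by
  simp [exceedances]

theorem exceedances_antitone : Antitone (exceedances x) := fun u v h =>
  Finset.sum_le_sum fun j _ => by
    by_cases hv : v < x j
    · simp [hv, h.trans_lt hv]
    · simp only [hv, if_false]; split_ifs <;> norm_num

theorem excessSum_antitone : Antitone (excessSum x) := fun u v h =>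
  Finset.sum_le_sum fun j _ => by
    split_ifs <;> linarith

theorem excessSum_nonneg (u : ℝ) : 0 ≤ excessSum x u :=
  Finset.sum_nonneg fun j _ => by split_ifs <;> linarith

/-- Turns order statistics into counts, to which the weak law applies. In increasing order, exactly
`i` places are at or after place `n - i`. -/
theorem lt_upperOrderStat_iff {i : ℕ} (h1 : 1 ≤ i) (hn : i ≤ n) (u : ℝ) :
    u < upperOrderStat x i ↔ (i : ℝ) ≤ exceedances x u := by
  have hmono := Tuple.monotone_sort x
  have hcard : (Finset.univ.filter fun j => u < x j).card
      = (Finset.univ.filter fun j => u < x (Tuple.sort x j)).card := by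
    symm
    refine Finset.card_bij (fun j _ => Tuple.sort x j) (by simp)
      (fun a _ b _ h => (Tuple.sort x).injective h) fun b hb => ?_
    exact ⟨(Tuple.sort x).symm b, by simpa using hb, by simp⟩
  rw [exceedances_eq_card, Nat.cast_le, hcard, upperOrderStat, dif_pos ⟨h1, hn⟩]
  constructor
  · intro hu
    have hsub : Finset.Ici (⟨n - i, by omega⟩ : Fin n)
        ⊆ Finset.univ.filter fun j => u < x (Tuple.sort x j) := fun j hj => by
      simp only [Finset.mem_filter, Finset.mem_univ, true_and]
      exact hu.trans_le (hmono (Finset.mem_Ici.1 hj))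
    have := Finset.card_le_card hsub
    rw [Fin.card_Ici] at this
    simp only at this
    omega
  · intro hi
    by_contra hu
    have hsub : (Finset.univ.filter fun j => u < x (Tuple.sort x j))
        ⊆ Finset.Ioi (⟨n - i, by omega⟩ : Fin n) := fun j hj => by
      simp only [Finset.mem_filter, Finset.mem_univ, true_and] at hj
      rw [Finset.mem_Ioi]
      by_contra hc
      exact hu (hj.trans_le (hmono (not_lt.1 hc)))
    have := Finset.card_le_card hsub
    rw [Fin.card_Ioi] at this
    simp only at this
    omega

theorem upperOrderStat_anti {i k : ℕ} (h1 : 1 ≤ i) (hik : i ≤ k) (hn : k ≤ n) :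
    upperOrderStat x k ≤ upperOrderStat x i := by
  rw [upperOrderStat, upperOrderStat, dif_pos ⟨h1.trans hik, hn⟩, dif_pos ⟨h1, hik.trans hn⟩]
  exact Tuple.monotone_sort x (Fin.mk_le_mk.2 (by omega))

/-- The quotient need not be monotone in the level, but numerator and denominator both are, so two
levels control all those between. -/
theorem empiricalMeanExcess_mem_Icc {u v w : ℝ} (huv : u ≤ v) (hvw : v ≤ w)
    (hw : 0 < exceedances x w) :
    empiricalMeanExcess x v ∈
      Icc (excessSum x w / exceedances x u) (excessSum x u / exceedances x w) := by
  have hv : 0 < exceedances x v := hw.trans_le (exceedances_antitone x hvw)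
  exact ⟨div_le_div₀ (excessSum_nonneg x v) (excessSum_antitone x hvw) hv
      (exceedances_antitone x huv),
    div_le_div₀ (excessSum_nonneg x u) (excessSum_antitone x huv) hw
      (exceedances_antitone x hvw)⟩

/-- A level `u` that at least two and at most `k` sample points exceed, and `w` fewer than `u`,
have one of the order statistics `X_(2), …, X_(k)` between them. -/
theorem exists_upperOrderStat_mem_Ioc {k : ℕ} {u w : ℝ} (h2 : 2 ≤ exceedances x u)
    (hk : exceedances x u ≤ k) (hw : exceedances x w < exceedances x u) :
    ∃ i ∈ Icc 2 k, upperOrderStat x i ∈ Ioc u w := by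
  have he := exceedances_eq_card x u
  set m := (Finset.univ.filter fun j => u < x j).card
  have hmn : m ≤ n := (Finset.card_le_univ _).trans_eq (Fintype.card_fin n)
  rw [he] at h2 hk hw
  have h2' : 2 ≤ m := by exact_mod_cast h2
  -- With `m` points above `u`, `X_(m)` is the smallest of them.
  refine ⟨m, ⟨h2', by exact_mod_cast hk⟩, ?_, ?_⟩
  · rw [lt_upperOrderStat_iff x (by omega) hmn, he]
  · rw [← not_lt, lt_upperOrderStat_iff x (by omega) hmn]
    exact not_le.2 hw

theorem mem_scaledPlot {k : ℕ} {p : ℝ × ℝ} :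
    p ∈ (scaledPlot x k : Set (ℝ × ℝ)) ↔ ∃ i ∈ Icc 2 k,
      p = (upperOrderStat x i / upperOrderStat x k,
        empiricalMeanExcess x (upperOrderStat x i) / upperOrderStat x k) := by
  change p ∈ (1 / upperOrderStat x k) • topPlot x k ↔ _
  simp only [topPlot, mem_smul_set, mem_image, exists_exists_and_eq_and, Prod.smul_mk, smul_eq_mul]
  refine exists_congr fun i => and_congr_right fun _ => ?_
  rw [eq_comm, one_div_mul_eq_div, one_div_mul_eq_div]

end Sample

end MeanExcess

/-! ### Regular variation: Potter bound and Karamata's theorem -/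

namespace MeanExcess

section RegularVariation

variable {U : ℝ → ℝ} {α : ℝ}

/-- At a zero of `U` the quotient is `0 / 0 = 0`, which the limit `1` at `x = 1` excludes far out;
monotonicity carries positivity back to every `t`. -/
theorem RegularlyVarying.pos (h : RegularlyVarying U (-α)) (hU : Antitone U) (t : ℝ) :
    0 < U t := by
  have h1 := h.2 1 one_pos
  simp only [mul_one, Real.one_rpow] at h1
  obtain ⟨s, hs, hst, hs0⟩ := ((h1.eventually_ne one_ne_zero).and
    ((eventually_ge_atTop t).and (eventually_gt_atTop 0))).exists
  have : U s ≠ 0 := fun h0 => hs (by simp [h0])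
  exact ((h.1 s hs0).lt_of_ne' this).trans_le (hU hst)

theorem RegularlyVarying.tendsto_div (h : RegularlyVarying U (-α)) {x y : ℝ} (hx : 0 < x)
    (hy : 0 < y) : Tendsto (fun t => U (t * x) / U (t * y)) atTop (𝓝 ((x / y) ^ (-α))) := by
  refine ((h.2 (x / y) (by positivity)).comp (tendsto_id.atTop_mul_const hy)).congr fun t => ?_
  simp only [Function.comp, id]
  rw [mul_assoc, mul_div_cancel₀ x hy.ne']

/-- A Potter bound, obtained by iterating `U (2 * u) ≤ 2 ^ (-β) * U u`. The factor `2 ^ β` pays for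
rounding `y` down to a power of `2`. -/
theorem RegularlyVarying.exists_le_rpow (h : RegularlyVarying U (-α)) (hU : Antitone U) {β : ℝ}
    (hβ : 0 ≤ β) (hβα : β < α) :
    ∃ u₀ > 0, ∀ u ≥ u₀, ∀ y ≥ 1, U (u * y) ≤ 2 ^ β * y ^ (-β) * U u := by
  have hlt : (2 : ℝ) ^ (-α) < 2 ^ (-β) :=
    Real.rpow_lt_rpow_of_exponent_lt one_lt_two (by linarith)
  obtain ⟨u₀, hu₀⟩ := eventually_atTop.1 ((h.2 2 two_pos).eventually_lt_const hlt)
  refine ⟨max u₀ 1, by positivity, fun u hu y hy => ?_⟩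
  have hu0 : u₀ ≤ u := (le_max_left _ _).trans hu
  have hu1 : 0 < u := one_pos.trans_le ((le_max_right _ _).trans hu)
  have hpow : ∀ j : ℕ, U (u * 2 ^ j) ≤ (2 ^ j : ℝ) ^ (-β) * U u := by
    intro j
    induction j with
    | zero => simp
    | succ j ih =>
      have hle : u ≤ u * 2 ^ j := le_mul_of_one_le_right hu1.le (one_le_pow₀ one_le_two)
      have := ((div_lt_iff₀ (h.pos hU _)).1 (hu₀ _ (hu0.trans hle))).le
      rw [pow_succ, ← mul_assoc, Real.mul_rpow (by positivity) (by positivity)]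
      calc U (u * 2 ^ j * 2) ≤ 2 ^ (-β) * U (u * 2 ^ j) := this
        _ ≤ 2 ^ (-β) * ((2 ^ j : ℝ) ^ (-β) * U u) := by gcongr
        _ = _ := by ring
  obtain ⟨j, hj, hj'⟩ := exists_nat_pow_near hy one_lt_two
  have hb : (2 ^ j : ℝ) ^ (-β) ≤ 2 ^ β * y ^ (-β) := by
    have h1 : (2 ^ (j + 1) : ℝ) ^ (-β) ≤ y ^ (-β) :=
      Real.rpow_le_rpow_of_nonpos (by positivity) hj'.le (by linarith)
    rw [pow_succ, Real.mul_rpow (by positivity) (by positivity)] at h1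
    calc (2 ^ j : ℝ) ^ (-β) = 2 ^ β * ((2 ^ j : ℝ) ^ (-β) * 2 ^ (-β)) := by
          rw [mul_left_comm, ← Real.rpow_add two_pos]; simp
      _ ≤ _ := by gcongr
  calc U (u * y) ≤ U (u * 2 ^ j) := hU (by gcongr)
    _ ≤ (2 ^ j : ℝ) ^ (-β) * U u := hpow j
    _ ≤ _ := by have := (h.pos hU u).le; gcongr

theorem integrableOn_one_add_rpow {β : ℝ} (hβ : 1 < β) :
    IntegrableOn (fun s : ℝ => (1 + s) ^ (-β)) (Ioi 0) := by
  have := ((measurePreserving_add_left volume (1 : ℝ)).integrableOn_comp_preimage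
    (measurableEmbedding_addLeft 1) (f := fun y : ℝ => y ^ (-β)) (s := Ioi 1)).2
    (integrableOn_Ioi_rpow_of_lt (by linarith) one_pos)
  simpa [Function.comp_def] using this

theorem integral_one_add_rpow {β : ℝ} (hβ : 1 < β) :
    ∫ s in Ioi (0 : ℝ), (1 + s) ^ (-β) = 1 / (β - 1) := by
  have := (measurePreserving_add_left volume (1 : ℝ)).setIntegral_preimage_emb
    (measurableEmbedding_addLeft 1) (fun y : ℝ => y ^ (-β)) (Ioi 1)
  rw [integral_Ioi_rpow_of_lt (by linarith) one_pos] at this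
  simp only [preimage_const_add_Ioi, sub_self, Real.one_rpow] at this
  rw [this, neg_div, ← div_neg]
  congr 1; ring

/-- Karamata's theorem, for monotone functions. -/
theorem RegularlyVarying.tendsto_integral (h : RegularlyVarying U (-α)) (hU : Antitone U)
    (hα : 1 < α) :
    (∀ᶠ u in atTop, IntegrableOn (fun s => U (u * (1 + s)) / U u) (Ioi 0)) ∧
    Tendsto (fun u => ∫ s in Ioi 0, U (u * (1 + s)) / U u) atTop (𝓝 (1 / (α - 1))) := by
  obtain ⟨β, hβ1, hβα⟩ := exists_between hα
  obtain ⟨u₀, hu₀, hb⟩ := h.exists_le_rpow hU (by linarith) hβα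
  have hmeas : ∀ u, AEStronglyMeasurable (fun s => U (u * (1 + s)) / U u)
      (volume.restrict (Ioi 0)) := fun u =>
    ((hU.measurable.comp (by fun_prop)).div_const _).aestronglyMeasurable
  -- Since `1 < β < α`, the Potter bound is an integrable majorant independent of `u`.
  have hbound : ∀ᶠ u in atTop, ∀ᵐ s ∂(volume.restrict (Ioi (0 : ℝ))),
      ‖U (u * (1 + s)) / U u‖ ≤ 2 ^ β * (1 + s) ^ (-β) := by
    filter_upwards [eventually_ge_atTop u₀] with u hu
    refine (ae_restrict_mem measurableSet_Ioi).mono fun s hs => ?_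
    have hs : 0 < s := hs
    rw [Real.norm_of_nonneg (div_nonneg (h.pos hU _).le (h.pos hU _).le),
      div_le_iff₀ (h.pos hU _)]
    exact hb u hu _ (by linarith)
  have hint : Integrable (fun s : ℝ => 2 ^ β * (1 + s) ^ (-β)) (volume.restrict (Ioi 0)) :=
    (integrableOn_one_add_rpow hβ1).const_mul _
  refine ⟨hbound.mono fun u hu => hint.mono' (hmeas u) hu, ?_⟩
  rw [← integral_one_add_rpow hα]
  refine tendsto_integral_filter_of_dominated_convergence _ (Eventually.of_forall hmeas)
    hbound hint ?_
  refine (ae_restrict_mem measurableSet_Ioi).mono fun s hs => ?_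
  have hs : 0 < s := hs
  exact h.2 _ (by linarith)

end RegularVariation

/-! ### Normalizing levels and the mean excess of the law -/

section Tail

variable (ν : Measure ℝ)

theorem one_sub_cdf_antitone : Antitone fun x => 1 - cdf ν x := fun _ _ h =>
  sub_le_sub_left (monotone_cdf ν h) 1

theorem tendsto_one_sub_cdf : Tendsto (fun x => 1 - cdf ν x) atTop (𝓝 0) := by
  simpa using (tendsto_cdf_atTop ν).const_sub 1

/-- A sequence of levels that `k n` points of a sample of size `n` are expected to exceed. -/
theorem exists_scale {α : ℝ} (h : RegularlyVarying (fun x => 1 - cdf ν x) (-α))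
    (k : ℕ → ℕ) (hk : Tendsto k atTop atTop)
    (hkn : Tendsto (fun n => (k n : ℝ) / (n : ℝ)) atTop (𝓝 0)) :
    ∃ a : ℕ → ℝ, Tendsto a atTop atTop ∧ ∀ x > 0,
      Tendsto (fun n => n * (1 - cdf ν (a n * x)) / k n) atTop (𝓝 (x ^ (-α))) := by
  have hanti := one_sub_cdf_antitone ν
  set U : ℝ → ℝ := fun x => 1 - cdf ν x with hUdef
  have hpos := h.pos hanti
  have hquot : ∀ᶠ n : ℕ in atTop, 0 < (k n : ℝ) / n := by
    filter_upwards [hk.eventually_gt_atTop 0, eventually_gt_atTop 0] with n h1 h2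
    positivity
  -- The generalized inverse of the tail at `k n / n`.
  set a : ℕ → ℝ := fun n => sInf {x | U x ≤ (k n : ℝ) / n} with hadef
  have hne : ∀ᶠ n : ℕ in atTop, {x | U x ≤ (k n : ℝ) / n}.Nonempty := hquot.mono fun n hn =>
    ((tendsto_one_sub_cdf ν).eventually_le_const hn).exists
  have hbdd : ∀ M : ℝ, ∀ᶠ n : ℕ in atTop, ∀ x ∈ {x | U x ≤ (k n : ℝ) / n}, M ≤ x := fun M =>
    (hkn.eventually_lt_const (hpos M)).mono fun n hn x hx => by
      by_contra hc
      exact absurd ((hanti (not_le.1 hc).le).trans hx) (not_le.2 hn)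
  have ha : Tendsto a atTop atTop := by
    refine tendsto_atTop.2 fun M => ?_
    filter_upwards [hne, hbdd M] with n h1 h2
    exact le_csInf h1 h2
  have habove : ∀ y > 1, ∀ᶠ n : ℕ in atTop, U (a n * y) ≤ (k n : ℝ) / n := by
    intro y hy
    filter_upwards [ha.eventually_gt_atTop 0, hne] with n h0 h1
    obtain ⟨x, hx, hxy⟩ := exists_lt_of_csInf_lt h1 (show a n < a n * y by nlinarith)
    exact (hanti hxy.le).trans hx
  have hbelow : ∀ y < 1, ∀ᶠ n : ℕ in atTop, (k n : ℝ) / n < U (a n * y) := by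
    intro y hy
    filter_upwards [ha.eventually_gt_atTop 0, hbdd 0] with n h0 h1
    by_contra hc
    have : a n ≤ a n * y := csInf_le ⟨0, h1⟩ (not_lt.1 hc)
    nlinarith
  have hcont : Tendsto (fun y : ℝ => (1 / y) ^ (-α)) (𝓝 1) (𝓝 1) := by
    have : ContinuousAt (fun y : ℝ => (1 / y) ^ (-α)) 1 :=
      ContinuousAt.rpow_const (by fun_prop (disch := norm_num)) (Or.inl (by norm_num))
    simpa [ContinuousAt] using this
  have hlim : ∀ y > 0, Tendsto (fun n => U (a n) / U (a n * y)) atTop (𝓝 ((1 / y) ^ (-α))) :=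
    fun y hy => by simpa [Function.comp_def] using (h.tendsto_div one_pos hy).comp ha
  -- The tail may jump at `a n`; comparing with `a n * y` for `y` slightly below and above `1` shows
  -- that such jumps are asymptotically negligible.
  have hone : Tendsto (fun n : ℕ => n * U (a n) / k n) atTop (𝓝 1) := by
    have hrw : ∀ n : ℕ, n * U (a n) / k n = U (a n) / ((k n : ℝ) / n) := fun n => by
      rw [div_div_eq_mul_div, mul_comm]
    simp_rw [hrw]
    refine tendsto_order.2 ⟨fun b hb => ?_, fun b hb => ?_⟩
    · obtain ⟨y, hyb, hy0, hy1⟩ := (((hcont.mono_left nhdsWithin_le_nhds).eventually_const_lt hb).and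
        (Ioo_mem_nhdsLT zero_lt_one)).exists
      filter_upwards [(hlim y hy0).eventually_const_lt hyb, hbelow y hy1, hquot] with n h1 h2 h3
      exact h1.trans_le (by have := (hpos (a n)).le; gcongr)
    · obtain ⟨y, hyb, hy1⟩ := (((hcont.mono_left nhdsWithin_le_nhds).eventually_lt_const hb).and
        (self_mem_nhdsWithin (s := Ioi (1 : ℝ)))).exists
      have hy1 : 1 < y := hy1
      filter_upwards [(hlim y (by linarith)).eventually_lt_const hyb, habove y hy1, hquot]
        with n h1 h2 h3
      refine lt_of_le_of_lt ?_ h1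
      have := (hpos (a n)).le
      have := hpos (a n * y)
      gcongr
  refine ⟨a, ha, fun x hx => ?_⟩
  have := hone.mul ((h.2 x hx).comp ha)
  rw [one_mul] at this
  refine this.congr fun n => ?_
  have := (hpos (a n)).ne'
  simp only [Function.comp]
  field_simp
  rfl

variable [IsProbabilityMeasure ν]

theorem one_sub_cdf_eq (u : ℝ) : 1 - cdf ν u = ν.real (Ioi u) := by
  rw [cdf_eq_real, ← compl_Iic, probReal_compl_eq_one_sub measurableSet_Iic]

/-- The mean excess over a high level, in terms of the tail. -/
theorem tendsto_integral_excess {α : ℝ} (hα : 1 < α)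
    (h : RegularlyVarying (fun x => 1 - cdf ν x) (-α)) :
    (∀ᶠ u in atTop, Integrable (fun x => if u < x then x - u else 0) ν) ∧
    Tendsto (fun u => (∫ x, (if u < x then x - u else 0) ∂ν) / (u * (1 - cdf ν u))) atTop
      (𝓝 (1 / (α - 1))) := by
  have hanti := one_sub_cdf_antitone ν
  obtain ⟨hi, ht⟩ := h.tendsto_integral hanti hα
  -- The layer-cake formula then turns the mean of the rescaled excess into Karamata's integral.
  have hset : ∀ u > 0, ∀ s > 0, {x : ℝ | s < (if u < x then x - u else 0) / u}
      = Ioi (u * (1 + s)) := by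
    intro u hu s hs
    ext x
    simp only [mem_ofPred_eq, mem_Ioi, lt_div_iff₀ hu]
    have := mul_pos hu hs
    split_ifs <;> constructor <;> intro <;> nlinarith
  have hmeas : ∀ u : ℝ, Measurable fun x : ℝ => (if u < x then x - u else 0) / u := fun u =>
    (Measurable.ite measurableSet_Ioi (by fun_prop) measurable_const).div_const u
  have hnn : ∀ u > 0, 0 ≤ᵐ[ν] fun x : ℝ => (if u < x then x - u else 0) / u := fun u hu =>
    Eventually.of_forall fun x => div_nonneg (by split_ifs <;> linarith) hu.le
  have hint : ∀ᶠ u in atTop, Integrable (fun x => (if u < x then x - u else 0) / u) ν := by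
    filter_upwards [hi, eventually_gt_atTop 0] with u hu hu0
    refine ⟨(hmeas u).aestronglyMeasurable, ?_⟩
    rw [hasFiniteIntegral_iff_ofReal (hnn u hu0),
      lintegral_eq_lintegral_meas_lt _ (hnn u hu0) (hmeas u).aemeasurable]
    have hf : Integrable (fun s => 1 - cdf ν (u * (1 + s))) (volume.restrict (Ioi 0)) := by
      refine (hu.mul_const (1 - cdf ν u)).congr (Eventually.of_forall fun s => ?_)
      exact div_mul_cancel₀ _ (h.pos hanti u).ne'
    refine lt_of_le_of_lt (le_of_eq ?_) (hasFiniteIntegral_iff_ofReal ?_ |>.1 hf.2)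
    · refine setLIntegral_congr_fun measurableSet_Ioi fun s hs => ?_
      simp only [hset u hu0 s hs, one_sub_cdf_eq]
      exact (ofReal_measureReal (measure_ne_top _ _)).symm
    · exact Eventually.of_forall fun s => (h.pos hanti _).le
  refine ⟨?_, ht.congr' ?_⟩
  · filter_upwards [hint, eventually_gt_atTop 0] with u hu hu0
    refine (hu.mul_const u).congr (Eventually.of_forall fun x => ?_)
    exact div_mul_cancel₀ _ hu0.ne'
  · filter_upwards [hint, eventually_gt_atTop 0] with u hu hu0
    rw [← div_div, ← integral_div, hu.integral_eq_integral_meas_lt (hnn u hu0), ← integral_div]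
    refine setIntegral_congr_fun measurableSet_Ioi fun s hs => ?_
    simp only [hset u hu0 s hs, one_sub_cdf_eq]

end Tail

end MeanExcess

/-! ### Convergence in probability as convergence along a filter -/

namespace MeanExcess

section ProbFilter

variable {Ω : Type*} [MeasurableSpace Ω] (μ : Measure Ω)

/-- The sets of pairs `(n, ω)` whose `n`-th section has probability tending to `1`. Convergence in
probability is convergence along this filter. -/
def probFilter : Filter (ℕ × Ω) where
  sets := {A | Tendsto (fun n => μ {ω | (n, ω) ∉ A}) atTop (𝓝 0)}
  univ_sets := by simp
  sets_of_superset {A B} hA hAB := by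
    refine tendsto_of_tendsto_of_tendsto_of_le_of_le tendsto_const_nhds hA
      (fun _ => zero_le) fun n => measure_mono fun ω hω h => hω (hAB h)
  inter_sets {A B} hA hB := by
    have := hA.add hB
    rw [add_zero] at this
    refine tendsto_of_tendsto_of_tendsto_of_le_of_le tendsto_const_nhds this
      (fun _ => zero_le) fun n => (measure_mono fun ω hω => ?_).trans (measure_union_le _ _)
    exact not_and_or.1 hω

theorem mem_probFilter {A : Set (ℕ × Ω)} :
    A ∈ probFilter μ ↔ Tendsto (fun n => μ {ω | (n, ω) ∉ A}) atTop (𝓝 0) := Iff.rfl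

theorem tendstoInProb_iff {T : Type*} (τ : TopologicalSpace T) (S : ℕ → Ω → T) (s : T) :
    TendstoInProb μ τ S s ↔ Tendsto (fun q : ℕ × Ω => S q.1 q.2) (probFilter μ) (@nhds T τ s) :=
  Iff.rfl

theorem tendsto_fst_probFilter : Tendsto Prod.fst (probFilter μ) (atTop : Filter ℕ) := by
  intro A hA
  rw [mem_map, mem_probFilter]
  refine tendsto_const_nhds.congr' ?_
  filter_upwards [hA] with n hn
  simp [hn]

end ProbFilter

/-! ### A weak law for triangular arrays -/

section WeakLaw

variable {Ω : Type*} [MeasurableSpace Ω] {μ : Measure Ω} [IsProbabilityMeasure μ]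
  {X : ℕ → Ω → ℝ}

/-- A truncated Chebyshev inequality. -/
theorem measure_le_abs_sum_sub_le (hmeas : ∀ i, Measurable (X i)) (hindep : iIndepFun X μ)
    (hident : ∀ i, IdentDistrib (X i) (X 0) μ μ) {g : ℝ → ℝ} (hg : Measurable g)
    (hg0 : ∀ x, 0 ≤ g x) (hgi : Integrable g (μ.map (X 0))) (n : ℕ) {T δ : ℝ} (hT : 0 ≤ T)
    (hδ : 0 < δ) :
    μ {ω | δ ≤ |∑ j : Fin n, g (X j ω) - n * ∫ x, g x ∂(μ.map (X 0))|} ≤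
      ENNReal.ofReal (4 * T * (n * ∫ x, g x ∂(μ.map (X 0))) / δ ^ 2 +
        2 * (n * ∫ x, max (g x - T) 0 ∂(μ.map (X 0))) / δ) := by
  have hν : IsProbabilityMeasure (μ.map (X 0)) :=
    Measure.isProbabilityMeasure_map (hmeas 0).aemeasurable
  have hlaw : ∀ i, μ.map (X i) = μ.map (X 0) := fun i => (hident i).map_eq
  set ν := μ.map (X 0)
  have hint : ∀ f : ℝ → ℝ, Measurable f → ∀ i, ∫ ω, f (X i ω) ∂μ = ∫ x, f x ∂ν := fun f hf i => by
    rw [← hlaw i, integral_map (hmeas i).aemeasurable hf.aestronglyMeasurable]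
  have hinteg : ∀ f : ℝ → ℝ, Integrable f ν → ∀ i, Integrable (fun ω => f (X i ω)) μ :=
    fun f hf i => by rw [← hlaw i] at hf; exact hf.comp_measurable (hmeas i)
  -- No second moment of `g` is assumed: Chebyshev handles the truncation `p`, whose second moment
  -- is at most `T` times the mean of `g`, and Markov the remainder `r`.
  set p : ℝ → ℝ := fun x => min (g x) T with hp
  set r : ℝ → ℝ := fun x => max (g x - T) 0 with hr
  have hpm : Measurable p := hg.min measurable_const
  have hrm : Measurable r := (hg.sub_const T).max measurable_const
  have hp0 : ∀ x, 0 ≤ p x := fun x => le_min (hg0 x) hT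
  have hr0 : ∀ x, 0 ≤ r x := fun x => le_max_right _ _
  have hpr : ∀ x, g x = p x + r x := fun x => by
    simp only [hp, hr]
    rcases le_total (g x) T with h | h
    · rw [min_eq_left h, max_eq_right (by linarith)]; ring
    · rw [min_eq_right h, max_eq_left (by linarith)]; ring
  have hpi : Integrable p ν := hgi.mono' hpm.aestronglyMeasurable
    (Eventually.of_forall fun x => by
      rw [Real.norm_of_nonneg (hp0 x)]; exact min_le_left _ _)
  have hri : Integrable r ν := hgi.mono' hrm.aestronglyMeasurable
    (Eventually.of_forall fun x => by
      rw [Real.norm_of_nonneg (hr0 x)]; linarith [hpr x, hp0 x])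
  have hsplit : ∫ x, g x ∂ν = ∫ x, p x ∂ν + ∫ x, r x ∂ν := by
    rw [← integral_add hpi hri]; exact integral_congr_ae (Eventually.of_forall hpr)
  have hL2 : ∀ i, MemLp (fun ω => p (X i ω)) 2 μ := fun i =>
    MemLp.of_bound (hpm.comp (hmeas i)).aestronglyMeasurable T (Eventually.of_forall fun ω => by
      rw [Real.norm_of_nonneg (hp0 _)]; exact min_le_right _ _)
  have hvar : ∀ i, Var[fun ω => p (X i ω); μ] ≤ T * ∫ x, g x ∂ν := fun i => by
    refine (variance_le_expectation_sq (hpm.comp (hmeas i)).aestronglyMeasurable).trans ?_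
    rw [← hint g hg i, ← integral_const_mul]
    refine integral_mono (hL2 i).integrable_sq ((hinteg g hgi i).const_mul T) fun ω => ?_
    simp only [Pi.pow_apply, sq]
    exact mul_le_mul (min_le_right _ _) (min_le_left _ _) (hp0 _) hT
  have hP : ∫ ω, (∑ j : Fin n, p (X j ω)) ∂μ = n * ∫ x, p x ∂ν := by
    rw [integral_finsetSum Finset.univ fun (j : Fin n) _ => hinteg p hpi j]
    simp [hint p hpm]
  have hR : ∫ ω, (∑ j : Fin n, r (X j ω)) ∂μ = n * ∫ x, r x ∂ν := by
    rw [integral_finsetSum Finset.univ fun (j : Fin n) _ => hinteg r hri j]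
    simp [hint r hrm]
  have hPL2 : MemLp (fun ω => ∑ j : Fin n, p (X j ω)) 2 μ :=
    memLp_finsetSum _ fun j _ => hL2 j
  have hVar : Var[fun ω => ∑ j : Fin n, p (X j ω); μ] ≤ n * (T * ∫ x, g x ∂ν) := by
    have h1 := IndepFun.variance_sum (μ := μ) (s := Finset.univ)
      (X := fun (j : Fin n) ω => p (X j ω)) (fun j _ => hL2 j) fun i _ j _ hij =>
        (hindep.indepFun fun h => hij (Fin.ext h)).comp hpm hpm
    have h2 : (∑ j : Fin n, fun ω => p (X j ω)) = fun ω => ∑ j : Fin n, p (X j ω) := by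
      ext ω; simp
    rw [h2] at h1
    rw [h1]
    exact (Finset.sum_le_sum fun (j : Fin n) _ => hvar j).trans_eq (by simp)
  have hg_nonneg : 0 ≤ ∫ x, g x ∂ν := integral_nonneg hg0
  have hr_nonneg : 0 ≤ ∫ x, r x ∂ν := integral_nonneg hr0
  -- In the first case the claimed bound is at least `1`; in the second, centring the remainder
  -- shifts the sum by less than `δ / 2`.
  rcases le_or_gt (δ / 2) (n * ∫ x, r x ∂ν) with hbig | hsmall
  · refine prob_le_one.trans (ENNReal.one_le_ofReal.2 ?_)
    have h1 : 1 ≤ 2 * (n * ∫ x, r x ∂ν) / δ := by rw [le_div_iff₀ hδ]; linarith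
    have h2 : 0 ≤ 4 * T * (n * ∫ x, g x ∂ν) / δ ^ 2 := by positivity
    linarith
  have hsub : {ω | δ ≤ |∑ j : Fin n, g (X j ω) - n * ∫ x, g x ∂ν|} ⊆
      {ω | δ / 2 ≤ |∑ j : Fin n, p (X j ω) - ∫ ω, (∑ j : Fin n, p (X j ω)) ∂μ|} ∪
      {ω | δ / 2 ≤ ∑ j : Fin n, r (X j ω)} := by
    intro ω hω
    by_contra hc
    simp only [mem_union, mem_ofPred_eq, not_or, not_le, hP] at hc hω
    have hs : ∑ j : Fin n, g (X j ω) = ∑ j : Fin n, p (X j ω) + ∑ j : Fin n, r (X j ω) := by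
      rw [← Finset.sum_add_distrib]; exact Finset.sum_congr rfl fun j _ => hpr _
    have hs0 : 0 ≤ ∑ j : Fin n, r (X j ω) := Finset.sum_nonneg fun j _ => hr0 _
    have hR0 : 0 ≤ n * ∫ x, r x ∂ν := by positivity
    rw [hs, hsplit] at hω
    have := abs_lt.1 hc.1
    refine absurd hω (not_le.2 (abs_lt.2 ⟨?_, ?_⟩)) <;> linarith [hc.2]
  refine (measure_mono hsub).trans ((measure_union_le _ _).trans ?_)
  rw [ENNReal.ofReal_add (by positivity) (by positivity)]
  refine add_le_add ?_ ?_
  · refine (meas_ge_le_variance_div_sq hPL2 (half_pos hδ)).trans (ENNReal.ofReal_le_ofReal ?_)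
    rw [div_le_div_iff₀ (by positivity) (by positivity)]
    nlinarith [sq_nonneg δ]
  · have := mul_meas_ge_le_integral_of_nonneg (μ := μ) (f := fun ω => ∑ j : Fin n, r (X j ω))
      (Eventually.of_forall fun ω => Finset.sum_nonneg fun j _ => hr0 _)
      (integrable_finsetSum _ fun j _ => hinteg r hri j) (δ / 2)
    rw [hR] at this
    rw [← ofReal_measureReal (measure_ne_top _ _)]
    refine ENNReal.ofReal_le_ofReal ?_
    rw [le_div_iff₀ hδ]
    linarith

/-- A weak law of large numbers for sums of `n` identically distributed nonnegative variables
`g n (X j)`, normalized by `k n`. -/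
theorem tendsto_sum_div (hmeas : ∀ i, Measurable (X i)) (hindep : iIndepFun X μ)
    (hident : ∀ i, IdentDistrib (X i) (X 0) μ μ) {k : ℕ → ℕ} (hk : Tendsto k atTop atTop)
    {g : ℕ → ℝ → ℝ} (hg : ∀ n, Measurable (g n)) (hg0 : ∀ᶠ n in atTop, ∀ x, 0 ≤ g n x)
    (hgi : ∀ᶠ n in atTop, Integrable (g n) (μ.map (X 0))) {c : ℝ}
    (hc : Tendsto (fun n => n * (∫ x, g n x ∂(μ.map (X 0))) / k n) atTop (𝓝 c))
    (htail : ∀ η > 0, ∃ T ≥ 0, ∀ᶠ n in atTop,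
      n * (∫ x, max (g n x - T) 0 ∂(μ.map (X 0))) / k n ≤ η) :
    Tendsto (fun q : ℕ × Ω => (∑ j : Fin q.1, g q.1 (X j q.2)) / k q.1) (probFilter μ)
      (𝓝 c) := by
  have hdiff : Tendsto (fun q : ℕ × Ω => (∑ j : Fin q.1, g q.1 (X j q.2)) / k q.1 -
      q.1 * (∫ x, g q.1 x ∂(μ.map (X 0))) / k q.1) (probFilter μ) (𝓝 0) := by
    rw [Metric.tendsto_nhds]
    intro ε hε
    change _ ∈ probFilter μ
    rw [mem_probFilter, ENNReal.tendsto_nhds_zero]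
    intro η hη
    obtain ⟨η', hη', hη'η⟩ : ∃ η' : ℝ, 0 < η' ∧ ENNReal.ofReal η' ≤ η := by
      rcases eq_or_ne η ⊤ with rfl | h
      · exact ⟨1, one_pos, le_top⟩
      · exact ⟨η.toReal, ENNReal.toReal_pos hη.ne' h, ENNReal.ofReal_toReal_le⟩
    -- Makes the Markov term at most `η' / 2`; for this fixed `T` the Chebyshev term is of order `1
    -- / k n`.
    obtain ⟨T, hT, htail⟩ := htail (η' * ε / 4) (by positivity)
    have hkR : Tendsto (fun n => (k n : ℝ)) atTop atTop := tendsto_natCast_atTop_atTop.comp hk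
    have hfirst : Tendsto (fun n => 4 * T / ε ^ 2 *
        (n * (∫ x, g n x ∂(μ.map (X 0))) / k n) * (k n : ℝ)⁻¹) atTop (𝓝 0) := by
      simpa using (hc.const_mul (4 * T / ε ^ 2)).mul (tendsto_inv_atTop_zero.comp hkR)
    filter_upwards [htail, hfirst.eventually_le_const (half_pos hη'), hgi,
      hkR.eventually_gt_atTop 0, hg0] with n h1 h2 h3 hk0 hn0
    refine le_trans ?_ hη'η
    have hset : {ω | (n, ω) ∉ {q : ℕ × Ω | dist ((∑ j : Fin q.1, g q.1 (X j q.2)) / k q.1 -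
        q.1 * (∫ x, g q.1 x ∂(μ.map (X 0))) / k q.1) 0 < ε}} =
        {ω | ε * k n ≤ |∑ j : Fin n, g n (X j ω) - n * ∫ x, g n x ∂(μ.map (X 0))|} := by
      ext ω
      simp only [mem_ofPred_eq, not_lt, dist_zero_right, Real.norm_eq_abs, ← sub_div, abs_div,
        abs_of_pos hk0, le_div_iff₀ hk0]
    refine ((measure_mono hset.le).trans (measure_le_abs_sum_sub_le hmeas hindep hident (hg n)
      hn0 h3 n hT (mul_pos hε hk0))).trans (ENNReal.ofReal_le_ofReal ?_)
    have e1 : 4 * T * (n * ∫ x, g n x ∂(μ.map (X 0))) / (ε * k n) ^ 2 = 4 * T / ε ^ 2 *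
        (n * (∫ x, g n x ∂(μ.map (X 0))) / k n) * (k n : ℝ)⁻¹ := by
      field_simp
    have e2 : 2 * (n * ∫ x, max (g n x - T) 0 ∂(μ.map (X 0))) / (ε * k n) =
        2 / ε * (n * (∫ x, max (g n x - T) 0 ∂(μ.map (X 0))) / k n) := by
      field_simp
    rw [e1, e2]
    have h4 : 2 / ε * (n * (∫ x, max (g n x - T) 0 ∂(μ.map (X 0))) / k n) ≤
        2 / ε * (η' * ε / 4) := by gcongr
    have h5 : 2 / ε * (η' * ε / 4) = η' / 2 := by field_simp; norm_num
    linarith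
  simpa using hdiff.add (hc.comp (tendsto_fst_probFilter μ))

end WeakLaw

end MeanExcess

/-! ### Limits of the counts and of the excess sums -/

namespace MeanExcess

section Limits

variable {Ω : Type*} [MeasurableSpace Ω] {μ : Measure Ω} [IsProbabilityMeasure μ]
  {X : ℕ → Ω → ℝ} {α : ℝ} {k : ℕ → ℕ} {a : ℕ → ℝ}

theorem tendsto_exceedances (hmeas : ∀ i, Measurable (X i)) (hindep : iIndepFun X μ)
    (hident : ∀ i, IdentDistrib (X i) (X 0) μ μ) (hk : Tendsto k atTop atTop) {t : ℝ}
    (ht : Tendsto (fun n => n * (1 - cdf (μ.map (X 0)) (a n * t)) / k n) atTop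
      (𝓝 (t ^ (-α)))) :
    Tendsto (fun q : ℕ × Ω => exceedances (fun j : Fin q.1 => X j q.2) (a q.1 * t) / k q.1)
      (probFilter μ) (𝓝 (t ^ (-α))) := by
  have hν : IsProbabilityMeasure (μ.map (X 0)) :=
    Measure.isProbabilityMeasure_map (hmeas 0).aemeasurable
  have hind : ∀ u : ℝ, (fun x : ℝ => if u < x then (1 : ℝ) else 0) = (Ioi u).indicator 1 :=
    fun u => by ext x; simp [indicator, mem_Ioi]
  refine tendsto_sum_div (g := fun n x => if a n * t < x then (1 : ℝ) else 0) hmeas hindep hident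
    hk (fun n => Measurable.ite measurableSet_Ioi measurable_const measurable_const)
    (Eventually.of_forall fun n x => by positivity) (Eventually.of_forall fun n => ?_) ?_
    fun η hη => ⟨1, zero_le_one, Eventually.of_forall fun n => ?_⟩
  · rw [hind]
    exact (integrable_const (1 : ℝ)).indicator measurableSet_Ioi
  · refine ht.congr fun n => ?_
    rw [hind, integral_indicator_one measurableSet_Ioi, one_sub_cdf_eq]
  · have : ∀ x : ℝ, max ((if a n * t < x then (1 : ℝ) else 0) - 1) 0 = 0 := fun x => by
      split_ifs <;> norm_num
    simp [this, hη.le]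

/-- The truncation remainder is again an excess, over a higher level, so the tail condition of the
weak law reduces to the asymptotics of the mean at `t + T`. -/
theorem max_excess_div_sub {a t T : ℝ} (ha : 0 < a) (hT : 0 ≤ T) (x : ℝ) :
    max ((if a * t < x then x - a * t else 0) / a - T) 0 =
      (if a * (t + T) < x then x - a * (t + T) else 0) / a := by
  have hT' : 0 ≤ a * T := by positivity
  have e : (x - a * t) / a - T = (x - a * (t + T)) / a := by
    field_simp; ring
  rw [mul_add] at e ⊢
  split_ifs with h1 h2 h2
  · rw [e]
    exact max_eq_left (div_nonneg (by linarith) ha.le)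
  · rw [e, zero_div]
    exact max_eq_right (div_nonpos_of_nonpos_of_nonneg (by linarith) ha.le)
  · linarith
  · rw [zero_div]
    exact max_eq_right (by linarith)

theorem tendsto_mul_integral_excess {ν : Measure ℝ} [IsProbabilityMeasure ν] (hα : 1 < α)
    (hRV : RegularlyVarying (fun x => 1 - cdf ν x) (-α)) (ha : Tendsto a atTop atTop) {t : ℝ}
    (ht : 0 < t)
    (hlim : Tendsto (fun n => n * (1 - cdf ν (a n * t)) / k n) atTop (𝓝 (t ^ (-α)))) :
    Tendsto (fun n => n * (∫ x, (if a n * t < x then x - a n * t else 0) / a n ∂ν) / k n) atTop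
      (𝓝 (t ^ (1 - α) / (α - 1))) := by
  have h1 := (hlim.mul ((tendsto_integral_excess ν hα hRV).2.comp
    (ha.atTop_mul_const ht))).const_mul t
  have e : t * (t ^ (-α) * (1 / (α - 1))) = t ^ (1 - α) / (α - 1) := by
    rw [sub_eq_add_neg 1 α, Real.rpow_add ht, Real.rpow_one]; ring
  rw [e] at h1
  refine h1.congr' ?_
  filter_upwards [ha.eventually_gt_atTop 0] with n hn
  have hv := hRV.pos (one_sub_cdf_antitone ν) (a n * t)
  simp only [Function.comp, integral_div]
  generalize 1 - cdf ν (a n * t) = v at hv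
  generalize (∫ x, (if a n * t < x then x - a n * t else 0) ∂ν) = I
  field_simp

theorem tendsto_excessSum (hmeas : ∀ i, Measurable (X i)) (hindep : iIndepFun X μ)
    (hident : ∀ i, IdentDistrib (X i) (X 0) μ μ) (hk : Tendsto k atTop atTop) (hα : 1 < α)
    (hRV : RegularlyVarying (fun x => 1 - cdf (μ.map (X 0)) x) (-α)) (ha : Tendsto a atTop atTop)
    (hlim : ∀ t > 0, Tendsto (fun n => n * (1 - cdf (μ.map (X 0)) (a n * t)) / k n) atTop
      (𝓝 (t ^ (-α)))) {t : ℝ} (ht : 0 < t) :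
    Tendsto (fun q : ℕ × Ω =>
        excessSum (fun j : Fin q.1 => X j q.2) (a q.1 * t) / a q.1 / k q.1)
      (probFilter μ) (𝓝 (t ^ (1 - α) / (α - 1))) := by
  have hν : IsProbabilityMeasure (μ.map (X 0)) :=
    Measure.isProbabilityMeasure_map (hmeas 0).aemeasurable
  have hsum : ∀ q : ℕ × Ω,
      excessSum (fun j : Fin q.1 => X j q.2) (a q.1 * t) / a q.1 =
      ∑ j : Fin q.1, (if a q.1 * t < X j q.2 then X j q.2 - a q.1 * t else 0) / a q.1 :=
    fun q => by rw [excessSum, Finset.sum_div]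
  simp_rw [hsum]
  refine tendsto_sum_div (g := fun n x => (if a n * t < x then x - a n * t else 0) / a n)
    hmeas hindep hident hk (fun n => (Measurable.ite measurableSet_Ioi
    (by fun_prop) measurable_const).div_const _) ?_ ?_
    (tendsto_mul_integral_excess hα hRV ha ht (hlim t ht)) fun η hη => ?_
  · filter_upwards [ha.eventually_gt_atTop 0] with n hn x
    exact div_nonneg (by split_ifs <;> linarith) hn.le
  · filter_upwards [(ha.atTop_mul_const ht).eventually (tendsto_integral_excess _ hα hRV).1]
      with n hn
    exact hn.div_const _
  · have hz : Tendsto (fun T : ℝ => (t + T) ^ (1 - α) / (α - 1)) atTop (𝓝 0) := by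
      have := (tendsto_rpow_neg_atTop (show 0 < α - 1 by linarith)).comp
        (tendsto_atTop_add_const_left atTop t tendsto_id)
      simpa [Function.comp_def] using this.div_const (α - 1)
    obtain ⟨T, hT, hT0⟩ := ((hz.eventually_lt_const hη).and (eventually_ge_atTop 0)).exists
    have htT : 0 < t + T := by linarith
    refine ⟨T, hT0, ?_⟩
    filter_upwards [(tendsto_mul_integral_excess hα hRV ha htT
      (hlim _ htT)).eventually_lt_const hT, ha.eventually_gt_atTop 0] with n h1 hn
    simp only [max_excess_div_sub hn hT0]
    exact h1.le

end Limits

end MeanExcess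

/-! ### From fixed levels to the plot -/

namespace MeanExcess

/-- For levels `x < y`, the limit of the ratio of the excess sum over `x` and the exceedances
of `y`. -/
noncomputable def ratioLimit (α x y : ℝ) : ℝ := x ^ (1 - α) / (α - 1) / y ^ (-α)

theorem ratioLimit_self (α : ℝ) {t : ℝ} (ht : 0 < t) : ratioLimit α t t = t / (α - 1) := by
  have : t ^ (-α) ≠ 0 := (Real.rpow_pos_of_pos ht _).ne'
  rw [ratioLimit, sub_eq_add_neg 1 α, Real.rpow_add ht, Real.rpow_one]
  field_simp

/-- Continuity of `ratioLimit` at the diagonal, with `x = t - δ` and `y = t + δ` for small `δ`. -/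
theorem exists_bracket {α t l u lo hi : ℝ} (ht : 0 < t) (hl : l < t) (hu : t < u)
    (hlo : lo < t / (α - 1)) (hhi : t / (α - 1) < hi) :
    ∃ x y, 0 < x ∧ l < x ∧ x < t ∧ t < y ∧ y < u ∧ lo < ratioLimit α y x ∧
      ratioLimit α x y < hi := by
  have hm : Tendsto (fun δ : ℝ => t - δ) (𝓝[>] 0) (𝓝 t) := by
    have : Tendsto (fun δ : ℝ => t - δ) (𝓝 0) (𝓝 (t - 0)) :=
      Continuous.tendsto (by fun_prop) 0
    rw [sub_zero] at this
    exact this.mono_left nhdsWithin_le_nhds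
  have hp : Tendsto (fun δ : ℝ => t + δ) (𝓝[>] 0) (𝓝 t) := by
    have : Tendsto (fun δ : ℝ => t + δ) (𝓝 0) (𝓝 (t + 0)) :=
      Continuous.tendsto (by fun_prop) 0
    rw [add_zero] at this
    exact this.mono_left nhdsWithin_le_nhds
  have hr : ∀ {f g : ℝ → ℝ}, Tendsto f (𝓝[>] 0) (𝓝 t) → Tendsto g (𝓝[>] 0) (𝓝 t) →
      Tendsto (fun δ => ratioLimit α (f δ) (g δ)) (𝓝[>] 0) (𝓝 (t / (α - 1))) := by
    intro f g hf hg
    rw [← ratioLimit_self α ht]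
    exact ((hf.rpow_const (Or.inl ht.ne')).div_const _).div (hg.rpow_const (Or.inl ht.ne'))
      (Real.rpow_pos_of_pos ht _).ne'
  obtain ⟨δ, hδ, h1, h2, h3, h4, h5⟩ := ((eventually_mem_nhdsWithin (s := Ioi (0 : ℝ)) (a := 0)).and
    ((hm.eventually_const_lt ht).and ((hm.eventually_const_lt hl).and
    ((hp.eventually_lt_const hu).and (((hr hp hm).eventually_const_lt hlo).and
    ((hr hm hp).eventually_lt_const hhi)))))).exists
  have hδ : 0 < δ := hδ
  exact ⟨t - δ, t + δ, h1, h2, by linarith, by linarith, h3, h4, h5⟩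

section Plot

variable {Ω : Type*} {L : Filter (ℕ × Ω)} {X : ℕ → Ω → ℝ} {α : ℝ} {k : ℕ → ℕ} {a : ℕ → ℝ}

theorem tendsto_ratio (hL : Tendsto Prod.fst L atTop) (hk : Tendsto k atTop atTop)
    (hN : ∀ t > 0, Tendsto (fun q : ℕ × Ω => exceedances (fun j : Fin q.1 => X j q.2)
      (a q.1 * t) / k q.1) L (𝓝 (t ^ (-α))))
    (hS : ∀ t > 0, Tendsto (fun q : ℕ × Ω => excessSum (fun j : Fin q.1 => X j q.2)
      (a q.1 * t) / a q.1 / k q.1) L (𝓝 (t ^ (1 - α) / (α - 1))))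
    {x y : ℝ} (hx : 0 < x) (hy : 0 < y) :
    Tendsto (fun q : ℕ × Ω => excessSum (fun j : Fin q.1 => X j q.2) (a q.1 * x) /
      exceedances (fun j : Fin q.1 => X j q.2) (a q.1 * y) / a q.1) L
      (𝓝 (ratioLimit α x y)) := by
  refine ((hS x hx).div (hN y hy) (Real.rpow_pos_of_pos hy _).ne').congr' ?_
  filter_upwards [hL.eventually (hk.eventually_gt_atTop 0)] with q hq
  have hq : (0 : ℝ) < k q.1 := by exact_mod_cast hq
  rw [Pi.div_apply, div_div_div_cancel_right₀ hq.ne', div_right_comm]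

/-- `X_(k)` exceeds `a t` exactly when the normalized count is at least `1`, and its limit `t ^
(-α)` crosses `1` at `t = 1`. -/
theorem tendsto_upperOrderStat (hL : Tendsto Prod.fst L atTop) (hk : Tendsto k atTop atTop)
    (hkn : ∀ᶠ n in atTop, k n ≤ n) (ha : Tendsto a atTop atTop) (hα : 0 < α)
    (hN : ∀ t > 0, Tendsto (fun q : ℕ × Ω => exceedances (fun j : Fin q.1 => X j q.2)
      (a q.1 * t) / k q.1) L (𝓝 (t ^ (-α)))) :
    Tendsto (fun q : ℕ × Ω => upperOrderStat (fun j : Fin q.1 => X j q.2) (k q.1) / a q.1) L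
      (𝓝 1) := by
  have hiff : ∀ t, ∀ᶠ q in L, (t < upperOrderStat (fun j : Fin q.1 => X j q.2) (k q.1) / a q.1 ↔
      1 ≤ exceedances (fun j : Fin q.1 => X j q.2) (a q.1 * t) / k q.1) := fun t => by
    filter_upwards [hL.eventually (hk.eventually_gt_atTop 0), hL.eventually hkn,
      hL.eventually (ha.eventually_gt_atTop 0)] with q hk0 hkn ha0
    rw [lt_div_iff₀' ha0, lt_upperOrderStat_iff _ hk0 hkn,
      one_le_div (by exact_mod_cast hk0)]
  refine tendsto_order.2 ⟨fun b hb => ?_, fun b hb => ?_⟩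
  · obtain ⟨x, hbx, hx1⟩ := exists_between (max_lt hb zero_lt_one)
    have hx0 : 0 < x := (le_max_right _ _).trans_lt hbx
    filter_upwards [hiff x, (hN x hx0).eventually_const_lt
      (Real.one_lt_rpow_of_pos_of_lt_one_of_neg hx0 hx1 (neg_neg_of_pos hα))] with q h1 h2
    exact ((le_max_left _ _).trans_lt hbx).trans (h1.2 h2.le)
  · obtain ⟨x, hx1, hxb⟩ := exists_between hb
    filter_upwards [hiff x, (hN x (by linarith)).eventually_lt_const
      (Real.rpow_lt_one_of_one_lt_of_neg hx1 (neg_neg_of_pos hα))] with q h1 h2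
    exact (not_lt.1 fun h => absurd (h1.1 h) (not_le.2 h2)).trans_lt hxb

/-- Points of the plot near `(t, ·)` lie in the band around the limit line. -/
theorem eventually_mem_band (hL : Tendsto Prod.fst L atTop) (hk : Tendsto k atTop atTop)
    (ha : Tendsto a atTop atTop)
    (hN : ∀ t > 0, Tendsto (fun q : ℕ × Ω => exceedances (fun j : Fin q.1 => X j q.2)
      (a q.1 * t) / k q.1) L (𝓝 (t ^ (-α))))
    (hS : ∀ t > 0, Tendsto (fun q : ℕ × Ω => excessSum (fun j : Fin q.1 => X j q.2)
      (a q.1 * t) / a q.1 / k q.1) L (𝓝 (t ^ (1 - α) / (α - 1))))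
    {x y lo hi : ℝ} (hx : 0 < x) (hy : 0 < y) (hlo : lo < ratioLimit α y x)
    (hhi : ratioLimit α x y < hi) :
    ∀ᶠ q in L, ∀ v, x ≤ v / a q.1 → v / a q.1 ≤ y →
      empiricalMeanExcess (fun j : Fin q.1 => X j q.2) v / a q.1 ∈ Ioo lo hi := by
  filter_upwards [(tendsto_ratio hL hk hN hS hy hx).eventually_const_lt hlo,
    (tendsto_ratio hL hk hN hS hx hy).eventually_lt_const hhi,
    (hN y hy).eventually_const_lt (Real.rpow_pos_of_pos hy _),
    hL.eventually (ha.eventually_gt_atTop 0), hL.eventually (hk.eventually_gt_atTop 0)]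
    with q h1 h2 h3 ha0 hk0 v hv hv'
  have hk0 : (0 : ℝ) < k q.1 := by exact_mod_cast hk0
  have hm := empiricalMeanExcess_mem_Icc (fun j : Fin q.1 => X j q.2)
    ((le_div_iff₀' ha0).1 hv) ((div_le_iff₀' ha0).1 hv') ((div_pos_iff_of_pos_right hk0).1 h3)
  exact ⟨h1.trans_le (by gcongr; exact hm.1), lt_of_le_of_lt (by gcongr; exact hm.2) h2⟩

/-- Points off the limit line are locally avoided by the plot. -/
theorem eventually_notMem_scaledPlot (hL : Tendsto Prod.fst L atTop) (hk : Tendsto k atTop atTop)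
    (hkn : ∀ᶠ n in atTop, k n ≤ n) (ha : Tendsto a atTop atTop)
    (hN : ∀ t > 0, Tendsto (fun q : ℕ × Ω => exceedances (fun j : Fin q.1 => X j q.2)
      (a q.1 * t) / k q.1) L (𝓝 (t ^ (-α))))
    (hS : ∀ t > 0, Tendsto (fun q : ℕ × Ω => excessSum (fun j : Fin q.1 => X j q.2)
      (a q.1 * t) / a q.1 / k q.1) L (𝓝 (t ^ (1 - α) / (α - 1))))
    (hR : Tendsto (fun q : ℕ × Ω => upperOrderStat (fun j : Fin q.1 => X j q.2) (k q.1) / a q.1)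
      L (𝓝 1)) {p : ℝ × ℝ} (hp : 1 ≤ p.1 → p.2 ≠ p.1 / (α - 1)) :
    ∀ᶠ z in L ×ˢ 𝓝 p,
      z.2 ∉ (scaledPlot (fun j : Fin z.1.1 => X j z.1.2) (k z.1.1) : Set (ℝ × ℝ)) := by
  have hfst : Tendsto (fun z : (ℕ × Ω) × ℝ × ℝ => z.2.1) (L ×ˢ 𝓝 p) (𝓝 p.1) :=
    (continuous_fst.tendsto p).comp tendsto_snd
  have hsnd : Tendsto (fun z : (ℕ × Ω) × ℝ × ℝ => z.2.2) (L ×ˢ 𝓝 p) (𝓝 p.2) :=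
    (continuous_snd.tendsto p).comp tendsto_snd
  have hR' := hR.comp (tendsto_fst (g := 𝓝 p))
  have hRpos : ∀ᶠ q in L, 0 < upperOrderStat (fun j : Fin q.1 => X j q.2) (k q.1) := by
    filter_upwards [hR.eventually_const_lt one_pos, hL.eventually (ha.eventually_gt_atTop 0)]
      with q h1 h2
    exact (div_pos_iff_of_pos_right h2).1 h1
  rcases lt_or_ge p.1 1 with hp1 | hp1
  -- Left of `1` there are no points at all, since `X_(i) ≥ X_(k) > 0`.
  · filter_upwards [hfst.eventually_lt_const hp1, hRpos.prod_inl _,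
      (hL.eventually hkn).prod_inl _] with z h1 h2 h3 hz
    obtain ⟨i, hi, he⟩ := (mem_scaledPlot _).1 hz
    rw [he] at h1
    refine absurd h1 (not_lt.2 ((one_le_div h2).2 ?_))
    exact upperOrderStat_anti _ (one_le_two.trans hi.1) hi.2 h3
  · have hpp : 0 < p.1 := one_pos.trans_le hp1
    -- Multiplying by `X_(k) / a → 1` replaces the random scale `X_(k)` by `a`, where the band
    -- estimate applies.
    have hbox : ∀ lo hi, lo < p.1 / (α - 1) → p.1 / (α - 1) < hi → ∀ᶠ z in L ×ˢ 𝓝 p,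
        z.2 ∈ (scaledPlot (fun j : Fin z.1.1 => X j z.1.2) (k z.1.1) : Set (ℝ × ℝ)) →
        z.2.2 * (upperOrderStat (fun j : Fin z.1.1 => X j z.1.2) (k z.1.1) / a z.1.1)
          ∈ Ioo lo hi := by
      intro lo hi hlo hhi
      obtain ⟨x, y, hx0, -, hxt, hty, -, hlo', hhi'⟩ := exists_bracket (l := 0) hpp hpp
        (lt_add_one p.1) hlo hhi
      have hmul := hfst.mul hR'
      rw [mul_one] at hmul
      filter_upwards [hmul.eventually_const_lt hxt, hmul.eventually_lt_const hty,
        hRpos.prod_inl _, (eventually_mem_band hL hk ha hN hS hx0 (hpp.trans hty) hlo'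
          hhi').prod_inl _] with z h1 h2 h3 h4 hz
      obtain ⟨i, hi, he⟩ := (mem_scaledPlot _).1 hz
      simp only [Function.comp, he, div_mul_div_cancel₀ h3.ne'] at h1 h2 ⊢
      exact h4 _ h1.le h2.le
    have hmul := hsnd.mul hR'
    rw [mul_one] at hmul
    rcases lt_or_gt_of_ne (hp hp1) with h | h
    · obtain ⟨lo, h1, h2⟩ := exists_between h
      filter_upwards [hbox lo _ h2 (lt_add_one _), hmul.eventually_lt_const h1] with z h3 h4 hz
      exact lt_asymm (h3 hz).1 h4
    · obtain ⟨hi, h1, h2⟩ := exists_between h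
      filter_upwards [hbox _ hi (sub_one_lt _) h1, hmul.eventually_const_lt h2] with z h3 h4 hz
      exact lt_asymm (h3 hz).2 h4

/-- Neighbourhoods of points of the limit line are hit by the plot. -/
theorem eventually_nonempty_scaledPlot_inter (hL : Tendsto Prod.fst L atTop)
    (hk : Tendsto k atTop atTop) (ha : Tendsto a atTop atTop) (hα : 0 < α)
    (hN : ∀ t > 0, Tendsto (fun q : ℕ × Ω => exceedances (fun j : Fin q.1 => X j q.2)
      (a q.1 * t) / k q.1) L (𝓝 (t ^ (-α))))
    (hS : ∀ t > 0, Tendsto (fun q : ℕ × Ω => excessSum (fun j : Fin q.1 => X j q.2)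
      (a q.1 * t) / a q.1 / k q.1) L (𝓝 (t ^ (1 - α) / (α - 1))))
    (hR : Tendsto (fun q : ℕ × Ω => upperOrderStat (fun j : Fin q.1 => X j q.2) (k q.1) / a q.1)
      L (𝓝 1)) {t : ℝ} (ht : 1 < t) {G : Set (ℝ × ℝ)} (hG : G ∈ 𝓝 (t, t / (α - 1))) :
    ∀ᶠ q in L,
      ((scaledPlot (fun j : Fin q.1 => X j q.2) (k q.1) : Set (ℝ × ℝ)) ∩ G).Nonempty := by
  rw [nhds_prod_eq, ((nhds_basis_Ioo t).prod (nhds_basis_Ioo (t / (α - 1)))).mem_iff] at hG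
  obtain ⟨⟨⟨l, u⟩, lo, hi⟩, ⟨⟨hl, hu⟩, hlo, hhi⟩, hsub⟩ := hG
  simp only at hl hu hlo hhi hsub
  obtain ⟨lo', hlo1, hlo2⟩ := exists_between hlo
  obtain ⟨hi', hhi1, hhi2⟩ := exists_between hhi
  -- The bound `max l 1` forces `x > 1`, so that fewer than `k` points exceed `a x` and the order
  -- statistic found has index at most `k`.
  obtain ⟨x, y, hx0, hlx, hxt, hty, hyu, hlo', hhi'⟩ := exists_bracket (one_pos.trans ht)
    (max_lt hl ht) hu hlo2 hhi1
  have hx1 : 1 < x := (le_max_right _ _).trans_lt hlx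
  have hlx : l < x := (le_max_left _ _).trans_lt hlx
  have hy0 : 0 < y := by linarith
  have hdiv : ∀ c : ℝ, Tendsto (fun q : ℕ × Ω =>
      c / (upperOrderStat (fun j : Fin q.1 => X j q.2) (k q.1) / a q.1)) L (𝓝 c) := fun c => by
    simpa [Pi.div_def] using (tendsto_const_nhds (x := c)).div hR one_ne_zero
  have hkR : Tendsto (fun q : ℕ × Ω => (k q.1 : ℝ)) L atTop :=
    tendsto_natCast_atTop_atTop.comp (hk.comp hL)
  filter_upwards [(hN x hx0).eventually_lt_const
      (Real.rpow_lt_one_of_one_lt_of_neg hx1 (neg_neg_of_pos hα)),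
    (hN y hy0).eventually_lt (hN x hx0)
      (Real.rpow_lt_rpow_of_neg hx0 (hxt.trans hty) (neg_neg_of_pos hα)),
    ((hN x hx0).pos_mul_atTop (Real.rpow_pos_of_pos hx0 _) hkR).eventually_ge_atTop 2,
    eventually_mem_band hL hk ha hN hS hx0 hy0 hlo' hhi', hkR.eventually_gt_atTop 0,
    hL.eventually (ha.eventually_gt_atTop 0), hR.eventually_const_lt one_pos,
    (hdiv x).eventually_const_lt hlx, (hdiv y).eventually_lt_const hyu,
    (hdiv lo').eventually_const_lt hlo1, (hdiv hi').eventually_lt_const hhi2]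
    with q h1 h2 h3 h4 hk0 ha0 hR0 h5 h6 h7 h8
  rw [div_mul_cancel₀ _ hk0.ne'] at h3
  rw [div_lt_one hk0] at h1
  rw [div_lt_div_iff_of_pos_right hk0] at h2
  obtain ⟨i, hi, hiu⟩ := exists_upperOrderStat_mem_Ioc _ h3 h1.le h2
  have hxi := (le_div_iff₀' ha0).2 hiu.1.le
  have hiy := (div_le_iff₀' ha0).2 hiu.2
  have hb := h4 _ hxi hiy
  refine ⟨_, (mem_scaledPlot _).2 ⟨i, hi, rfl⟩, hsub ?_⟩
  rw [← div_div_div_cancel_right₀ ha0.ne' (upperOrderStat _ i),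
    ← div_div_div_cancel_right₀ ha0.ne' (empiricalMeanExcess _ _)]
  exact ⟨⟨h5.trans_le (div_le_div_of_nonneg_right hxi hR0.le),
      (div_le_div_of_nonneg_right hiy hR0.le).trans_lt h6⟩,
    ⟨h7.trans_le (div_le_div_of_nonneg_right hb.1.le hR0.le),
      (div_le_div_of_nonneg_right hb.2.le hR0.le).trans_lt h8⟩⟩

end Plot

end MeanExcess

/-! ### Convergence in the Fell topology -/

theorem theorem3p2 {Ω : Type*} [MeasurableSpace Ω] (μ : Measure Ω) [IsProbabilityMeasure μ]
    (X : ℕ → Ω → ℝ) (hmeas : ∀ i, Measurable (X i))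
    (hindep : iIndepFun X μ) (hident : ∀ i, IdentDistrib (X i) (X 0) μ μ)
    (ξ : ℝ) (hξ₀ : 0 < ξ) (hξ₁ : ξ < 1)
    (hRV : MeanExcess.RegularlyVarying (fun x => 1 - cdf (μ.map (X 0)) x) (-1 / ξ))
    (k : ℕ → ℕ) (hk : Tendsto k atTop atTop)
    (hkn : Tendsto (fun n => (k n : ℝ) / (n : ℝ)) atTop (𝓝 0)) :
    MeanExcess.TendstoInProb μ (MeanExcess.fellTopology (ℝ × ℝ))
      (fun n ω => MeanExcess.scaledPlot (fun j : Fin n => X j ω) (k n))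
      (MeanExcess.limitLine ξ) := by
  open MeanExcess in
  have hα : 1 < 1 / ξ := (one_lt_div hξ₀).2 hξ₁
  have hα0 : 0 < 1 / ξ := one_pos.trans hα
  have hslope : ∀ t : ℝ, ξ / (1 - ξ) * t = t / (1 / ξ - 1) := fun t => by
    have : 1 - ξ ≠ 0 := by linarith
    field_simp
  rw [neg_div] at hRV
  obtain ⟨a, ha, hlim⟩ := exists_scale _ hRV k hk hkn
  have hkn' : ∀ᶠ n in atTop, k n ≤ n := by
    filter_upwards [hkn.eventually_lt_const one_pos, eventually_gt_atTop 0] with n h1 h2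
    rw [div_lt_one (by exact_mod_cast h2)] at h1
    exact_mod_cast h1.le
  have hL := tendsto_fst_probFilter μ
  have hN := fun t (ht : t > 0) => tendsto_exceedances hmeas hindep hident hk (hlim t ht)
  have hS := fun t (ht : t > 0) => tendsto_excessSum hmeas hindep hident hk hα hRV ha hlim ht
  have hR := tendsto_upperOrderStat hL hk hkn' ha hα0 hN
  rw [tendstoInProb_iff, TopologicalSpace.tendsto_nhds_generateFrom_iff]
  rintro A (⟨K, hK, rfl⟩ | ⟨G, hG, rfl⟩) hA
  -- Compactness of `K` glues the local avoidance statements into one event.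
  · have hmem : {z : (ℕ × Ω) × ℝ × ℝ | z.2 ∉ (scaledPlot (fun j : Fin z.1.1 => X j z.1.2)
        (k z.1.1) : Set (ℝ × ℝ))} ∈ probFilter μ ×ˢ 𝓝ˢ K := by
      refine hK.mem_prod_nhdsSet_of_forall fun p hp =>
        eventually_notMem_scaledPlot hL hk hkn' ha hN hS hR fun h1 h2 => ?_
      have : p ∈ (limitLine ξ : Set (ℝ × ℝ)) ∩ K :=
        ⟨⟨p.1, h1, Prod.ext rfl (h2.trans (hslope _).symm)⟩, hp⟩
      rwa [hA] at this
    obtain ⟨A, hA, B, hB, hAB⟩ := mem_prod_iff.1 hmem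
    filter_upwards [hA] with q hq
    refine eq_empty_of_forall_notMem fun p hp => ?_
    exact hAB (mk_mem_prod hq (subset_of_mem_nhdsSet hB hp.2)) hp.1
  · obtain ⟨_, ⟨t, ht, rfl⟩, htG⟩ := hA
    -- The given point may be the endpoint `t = 1`; sliding along the line inside `G` gives `s > 1`.
    have hcont : Tendsto (fun s : ℝ => (s, ξ / (1 - ξ) * s)) (𝓝[>] t)
        (𝓝 (t, ξ / (1 - ξ) * t)) :=
      ((by fun_prop : Continuous fun s : ℝ => (s, ξ / (1 - ξ) * s)).tendsto t).mono_left
        nhdsWithin_le_nhds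
    obtain ⟨s, hsG, hts⟩ := ((hcont.eventually (hG.mem_nhds htG)).and
      (eventually_mem_nhdsWithin (s := Ioi t) (a := t))).exists
    rw [hslope] at hsG
    exact eventually_nonempty_scaledPlot_inter hL hk ha hα0 hN hS hR
      (lt_of_le_of_lt ht hts) (hG.mem_nhds hsG)
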